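/- Let $A$ be a complex Banach algebra with identity, let $H$ be a separable infinite-dimensional complex Hilbert space with orthonormal basis $(e_n)_{n\ge 1}$, let $K(H)$ be the algebra of compact operators on $H$ with the operator norm, and let $E_{ij}=e_ie_j^*\in K(H)$ be the matrix units. Let $A\otimes K(H)$ denote the completion $B$ of the algebraic tensor product $A\odot K(H)$ in a Banach algebra norm which is a cross norm ($\|a\otimes k\|=\|a\|\,\|k\|$), such that for every $n$ the corner $P_nBP_n$, where $P_n=\sum_{i=1}^n 1\otimes E_{ii}$, is $A\otimes \mathbb M_n=\operatorname{span}\{a\otimes E_{ij}: a\in A,\ 1\le i,j\le n\}$, and such that $\bigcup_n A\otimes\mathbb M_n$ is norm dense in $B$. For a unital Banach algebra $R$, let $Lg_n(R)$ (resp. $Rg_n(R)$) be the set of $(a_1,\dots,a_n)\in R^n$ for which there are $b_1,\dots,b_n\in R$ with $\sum_i b_ia_i=1$ (resp. $\sum_i a_ib_i=1$). Let $\mathrm{ltsr}(R)$ (resp. $\mathrm{rtsr}(R)$) be the least integer $n\ge 1$ for which $Lg_n(R)$ (resp. $Rg_n(R)$) is dense in $R^n$, or $\infty$ if there is none; for $B$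 these are taken in its unitization $\mathbb C\oplus B$ with norm $\|(z,b)\|=|z|+\|b\|$. Write $\mathrm{tsr}(R)=1$ if $\mathrm{ltsr}(R)=\mathrm{rtsr}(R)=1$. Then $$\mathrm{ltsr}(B)=\mathrm{rtsr}(B)\in\{1,2\},$$ and this common value is $1$ if and only if $\mathrm{tsr}(A)=1$. Moreover $\mathrm{tsr}(A)=1$ if and only if the invertible elements of $A$ are dense in $A$. -/

import Mathlib

open scoped TensorProduct

noncomputable section

namespace StableRank

/-! ### Topological stable ranks -/

section Ranks

variable (R : Type*) [NormedRing R]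

/-- `Lg n R`: the `n`-tuples of elements of `R` that generate `R` as a left ideal. -/
def Lg (n : ℕ) : Set (Fin n → R) := {a | ∃ b : Fin n → R, ∑ i, b i * a i = 1}

/-- `Rg n R`: the `n`-tuples of elements of `R` that generate `R` as a right ideal. -/
def Rg (n : ℕ) : Set (Fin n → R) := {a | ∃ b : Fin n → R, ∑ i, a i * b i = 1}

/-- Left topological stable rank of a unital Banach algebra: the least `n ≥ 1` for which the
left-generating `n`-tuples are dense in `R ^ n`, and `⊤` if there is none. -/
def ltsr : ℕ∞ := sInf ((fun n : ℕ => (n : ℕ∞)) '' {n : ℕ | 1 ≤ n ∧ Dense (Lg R n)})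

/-- Right topological stable rank of a unital Banach algebra. -/
def rtsr : ℕ∞ := sInf ((fun n : ℕ => (n : ℕ∞)) '' {n : ℕ | 1 ≤ n ∧ Dense (Rg R n)})

end Ranks

section NonUnital

variable (B : Type*) [NonUnitalNormedRing B] [NormedSpace ℂ B] [IsScalarTower ℂ B B]
  [SMulCommClass ℂ B B]

/-- Left topological stable rank of a non-unital Banach algebra: that of its unitization
`ℂ ⊕ B`, here normed by `‖(z, b)‖ = |z| + ‖b‖`. -/
def ltsrNonUnital : ℕ∞ := ltsr (WithLp 1 (Unitization ℂ B))

/-- Right topological stable rank of a non-unital Banach algebra. -/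
def rtsrNonUnital : ℕ∞ := rtsr (WithLp 1 (Unitization ℂ B))

end NonUnital

/-! ### Compact operators and matrix units -/

section Compact

variable (H : Type*) [NormedAddCommGroup H] [InnerProductSpace ℂ H]

/-- `K(H)`: the algebra of compact operators on `H`, with the operator norm. -/
def Compacts : NonUnitalSubalgebra ℂ (H →L[ℂ] H) where
  carrier := {f | IsCompactOperator f}
  add_mem' hf hg := IsCompactOperator.add hf hg
  zero_mem' := isCompactOperator_zero
  smul_mem' c _ hf := IsCompactOperator.smul hf c
  mul_mem' {_ g} hf _ := IsCompactOperator.comp_clm hf g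

variable {H}

theorem isCompactOperator_rankOne (x y : H) :
    IsCompactOperator (InnerProductSpace.rankOne ℂ x y : H →L[ℂ] H) :=
  (isCompactOperator_of_locallyCompactSpace_rng
    (ContinuousLinearMap.toSpanSingleton ℂ x)).comp_clm (innerSL ℂ y)

/-- The matrix unit `E i j = e i (e j)^*`, that is `v ↦ ⟪e j, v⟫ e i`. -/
def matrixUnit (e : HilbertBasis ℕ ℂ H) (i j : ℕ) : Compacts H :=
  ⟨InnerProductSpace.rankOne ℂ (e i) (e j), isCompactOperator_rankOne _ _⟩

end Compact

/-! ### Cross-norm completions of `A ⊗ K(H)` -/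

section CrossNorm

variable (A : Type*) [NormedRing A] [NormedAlgebra ℂ A]
  {H : Type*} [NormedAddCommGroup H] [InnerProductSpace ℂ H]

/-- `A ⊗ M_n` inside `A ⊗ K(H)`: the span of the `a ⊗ E i j` with `i, j < n`. -/
def matrixPart (e : HilbertBasis ℕ ℂ H) (n : ℕ) : Submodule ℂ (A ⊗[ℂ] Compacts H) :=
  Submodule.span ℂ {x | ∃ (a : A) (i j : ℕ), i < n ∧ j < n ∧ x = a ⊗ₜ[ℂ] matrixUnit e i j}

/-- The projection `∑_{i < n} 1 ⊗ E i i` in `A ⊗ K(H)`. -/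
def cornerUnit (e : HilbertBasis ℕ ℂ H) (n : ℕ) : A ⊗[ℂ] Compacts H :=
  ∑ i ∈ Finset.range n, (1 : A) ⊗ₜ[ℂ] matrixUnit e i i

variable {A}
variable {B : Type*} [NonUnitalNormedRing B] [NormedSpace ℂ B]

/-- `ι : A ⊗ K(H) → B` exhibits the Banach algebra `B` (complete in the theorem) as the
completion of the algebraic tensor product in a Banach algebra cross norm, namely `‖ι x‖`,
with the stated compatibility with matrix units. In particular `a ↦ ι (a ⊗ E 0 0)` is isometric,
by `norm_tmul` and `‖E 0 0‖ = 1`. -/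
structure IsCrossNormCompletion (e : HilbertBasis ℕ ℂ H)
    (ι : (A ⊗[ℂ] Compacts H) →ₙₐ[ℂ] B) : Prop where
  /-- `x ↦ ‖ι x‖` is a norm, not only a seminorm. -/
  injective : Function.Injective ι
  /-- It is a cross norm. -/
  norm_tmul : ∀ (a : A) (k : Compacts H), ‖ι (a ⊗ₜ[ℂ] k)‖ = ‖a‖ * ‖k‖
  /-- The corner of `B` cut out by `∑_{i < n} 1 ⊗ E i i` is `A ⊗ M_n`. -/
  corner_eq : ∀ n : ℕ, Set.range (fun b : B => ι (cornerUnit A e n) * b * ι (cornerUnit A e n))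
    = ι '' (matrixPart A e n : Set (A ⊗[ℂ] Compacts H))
  /-- The union of the matrix algebras `A ⊗ M_n` is dense. -/
  dense_matrixPart : Dense (⋃ n : ℕ, ι '' (matrixPart A e n : Set (A ⊗[ℂ] Compacts H)))

end CrossNorm

end StableRank

end

/-! In a complete normed ring, stable rank one on either side means that the units are dense. If `b
* a = 1` and left invertible elements are dense, a left invertible `c` close to `b` makes `c * a` a
unit, so `c` and then `a` are units. This gives the last claim, and makes the condition left-right
symmetric.

The unitization of `B` is handled through its dense set of elements `z • 1 + s`, with `z ≠ 0` and
`s` a finite matrix. A pair of these becomes generating once a small multiple of a shift, moving the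
finite support to unused indices, is added to the first one (`dense_Lg_two`, `dense_Rg_two`). So
both ranks are at most 2.

Density of units passes between `A` and the unitization by Schur complements. Upwards
(`one_add_mem_closure`), the last diagonal entry of `1 + s` is perturbed to a unit, and eliminating
it lowers the matrix size. Downwards (`dense_isUnit_of_dense_isUnit`), a unit near `a ⊕ 1` has its
Schur complement in the first corner, which is a unit of `A` near `a`. -/

namespace StableRank

open Filter Topology

/-! ### Rank one: one-sided inverses and density of units. -/

section RankOne

variable {R : Type*} [NormedRing R]

theorem mem_Lg_one {a : Fin 1 → R} : a ∈ Lg R 1 ↔ ∃ b, b * a 0 = 1 := by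
  constructor
  · rintro ⟨b, hb⟩
    exact ⟨b 0, by simpa using hb⟩
  · rintro ⟨b, hb⟩
    exact ⟨fun _ => b, by simpa using hb⟩

theorem mem_Rg_one {a : Fin 1 → R} : a ∈ Rg R 1 ↔ ∃ b, a 0 * b = 1 := by
  constructor
  · rintro ⟨b, hb⟩
    exact ⟨b 0, by simpa using hb⟩
  · rintro ⟨b, hb⟩
    exact ⟨fun _ => b, by simpa using hb⟩

theorem dense_fin_one_iff {S : Set (Fin 1 → R)} {T : Set R} (h : ∀ a, a ∈ S ↔ a 0 ∈ T) :
    Dense S ↔ Dense T := by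
  have : S = Homeomorph.funUnique (Fin 1) R ⁻¹' T := by
    ext a
    exact h a
  rw [this]
  refine ⟨fun hS => ?_, fun hT => hT.preimage (Homeomorph.funUnique (Fin 1) R).isOpenMap⟩
  have := (Homeomorph.funUnique (Fin 1) R).surjective.denseRange.dense_image
    (Homeomorph.funUnique (Fin 1) R).continuous hS
  exact this.mono (Set.image_preimage_subset _ _)

theorem dense_Lg_one_iff : Dense (Lg R 1) ↔ Dense {a : R | ∃ b, b * a = 1} :=
  dense_fin_one_iff fun _ => mem_Lg_one

theorem dense_Rg_one_iff : Dense (Rg R 1) ↔ Dense {a : R | ∃ b, a * b = 1} :=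
  dense_fin_one_iff fun _ => mem_Rg_one

theorem sInf_natCast_eq_one_iff {P : ℕ → Prop} :
    sInf ((fun n : ℕ => (n : ℕ∞)) '' {n : ℕ | 1 ≤ n ∧ P n}) = 1 ↔ P 1 := by
  constructor
  · intro h
    have hne : ((fun n : ℕ => (n : ℕ∞)) '' {n : ℕ | 1 ≤ n ∧ P n}).Nonempty := by
      by_contra hem
      rw [Set.not_nonempty_iff_eq_empty.1 hem, sInf_empty] at h
      exact absurd h (by simp)
    obtain ⟨n, hn, hn1⟩ := csInf_mem hne
    rw [h] at hn1
    dsimp only at hn1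
    have : n = 1 := by exact_mod_cast hn1
    exact this ▸ hn.2
  · intro h
    apply le_antisymm
    · exact sInf_le ⟨1, ⟨le_rfl, h⟩, by simp⟩
    · refine le_sInf ?_
      rintro _ ⟨n, hn, rfl⟩
      dsimp only
      exact_mod_cast hn.1

theorem sInf_natCast_eq_one_or_two {P : ℕ → Prop} (h : P 2) :
    sInf ((fun n : ℕ => (n : ℕ∞)) '' {n : ℕ | 1 ≤ n ∧ P n}) = 1 ∨
      sInf ((fun n : ℕ => (n : ℕ∞)) '' {n : ℕ | 1 ≤ n ∧ P n}) = 2 := by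
  obtain ⟨n, hn, hn1⟩ := csInf_mem
    (s := (fun n : ℕ => (n : ℕ∞)) '' {n : ℕ | 1 ≤ n ∧ P n}) ⟨_, ⟨2, ⟨by simp, h⟩, rfl⟩⟩
  have h2 : sInf ((fun n : ℕ => (n : ℕ∞)) '' {n : ℕ | 1 ≤ n ∧ P n}) ≤ ((2 : ℕ) : ℕ∞) :=
    sInf_le ⟨2, ⟨by simp, h⟩, rfl⟩
  rw [← hn1] at h2 ⊢
  dsimp only at h2 ⊢
  have h3 : n ≤ 2 := by exact_mod_cast h2
  have h1 : 1 ≤ n := hn.1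
  interval_cases n
  · left; simp
  · right; simp

/-- If the left invertible elements are dense, then they are all invertible. -/
theorem dense_isUnit_of_dense_left [CompleteSpace R] (h : Dense {a : R | ∃ b, b * a = 1}) :
    Dense {a : R | IsUnit a} := by
  refine h.mono ?_
  rintro a ⟨b, hb⟩
  have hc : Tendsto (fun x : R => x * a) (𝓝 b) (𝓝 1) := by
    have : ContinuousAt (fun x : R => x * a) b := by fun_prop
    simpa [ContinuousAt, hb] using this
  -- `c` is left invertible and so close to `b` that `c * a` is a unit. The latter gives `c` a right
  -- inverse as well.
  obtain ⟨c, ⟨d, hd⟩, hca⟩ := (mem_closure_iff_frequently.1 (h b)).and_eventually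
    (hc.eventually (Units.nhds (1 : Rˣ))) |>.exists
  obtain ⟨u, hu⟩ : IsUnit (c * a) := hca
  have hcr : c * (a * (↑u⁻¹ : R)) = 1 := by rw [← mul_assoc, ← hu, Units.mul_inv]
  have hda : d = a * (↑u⁻¹ : R) := left_inv_eq_right_inv hd hcr
  have hcu : IsUnit c := ⟨⟨c, d, hda ▸ hcr, hd⟩, rfl⟩
  obtain ⟨v, rfl⟩ := hcu
  have : a = (↑v⁻¹ : R) * u := by rw [hu, Units.inv_mul_cancel_left]
  rw [this]
  exact v⁻¹.isUnit.mul u.isUnit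

theorem dense_isUnit_of_dense_right [CompleteSpace R] (h : Dense {a : R | ∃ b, a * b = 1}) :
    Dense {a : R | IsUnit a} := by
  refine h.mono ?_
  rintro a ⟨b, hb⟩
  have hc : Tendsto (fun x : R => a * x) (𝓝 b) (𝓝 1) := by
    have : ContinuousAt (fun x : R => a * x) b := by fun_prop
    simpa [ContinuousAt, hb] using this
  obtain ⟨c, ⟨d, hd⟩, hca⟩ := (mem_closure_iff_frequently.1 (h b)).and_eventually
    (hc.eventually (Units.nhds (1 : Rˣ))) |>.exists
  obtain ⟨u, hu⟩ : IsUnit (a * c) := hca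
  have hcl : (↑u⁻¹ : R) * a * c = 1 := by rw [mul_assoc, ← hu, Units.inv_mul]
  have hda : (↑u⁻¹ : R) * a = d := left_inv_eq_right_inv hcl hd
  have hcu : IsUnit c := ⟨⟨c, d, hd, hda ▸ hcl⟩, rfl⟩
  obtain ⟨v, rfl⟩ := hcu
  have : a = u * (↑v⁻¹ : R) := by rw [hu, Units.mul_inv_cancel_right]
  rw [this]
  exact u.isUnit.mul v⁻¹.isUnit

theorem ltsr_eq_one_iff [CompleteSpace R] : ltsr R = 1 ↔ Dense {a : R | IsUnit a} := by
  rw [ltsr, sInf_natCast_eq_one_iff, dense_Lg_one_iff]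
  refine ⟨dense_isUnit_of_dense_left, fun h => h.mono ?_⟩
  rintro _ ⟨u, rfl⟩
  exact ⟨_, u.inv_mul⟩

theorem rtsr_eq_one_iff [CompleteSpace R] : rtsr R = 1 ↔ Dense {a : R | IsUnit a} := by
  rw [rtsr, sInf_natCast_eq_one_iff, dense_Rg_one_iff]
  refine ⟨dense_isUnit_of_dense_right, fun h => h.mono ?_⟩
  rintro _ ⟨u, rfl⟩
  exact ⟨_, u.mul_inv⟩

end RankOne

/-! ### Algebraic identities: Schur complements and generating pairs. -/

section Algebra

variable {R : Type*} [Ring R]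

theorem isUnit_one_sub_of_sq_eq_zero {x : R} (h : x * x = 0) : IsUnit (1 - x) :=
  ⟨⟨1 - x, 1 + x, by simp [mul_add, sub_mul, h], by simp [mul_sub, add_mul, h]⟩, rfl⟩

/-- The Schur complement factorization: if the corner `e y e` is invertible with inverse `w`,
then `y` is a product of units and the complement `1 + (y - y w y - 1 + e)`. -/
theorem schur_factorization {e w y : R} (hew : e * w = w) (hwe : w * e = w)
    (hl : w * y * e = e) (hr : e * y * w = e) :
    ∃ u₁ u₂ : Rˣ, y = u₁ * (1 + (y - y * w * y - 1 + e)) * u₂ := by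
  have hee : e * e = e := by
    calc e * e = e * (w * y * e) := by rw [hl]
      _ = e * w * y * e := by simp only [mul_assoc]
      _ = e := by rw [hew, hl]
  have hwyw : w * y * w = w := by
    calc w * y * w = w * y * (e * w) := by rw [hew]
      _ = w * y * e * w := by simp only [mul_assoc]
      _ = w := by rw [hl, hew]
  have hwf : w * (1 - e) = 0 := by rw [mul_sub, hwe, mul_one, sub_self]
  have hfw : (1 - e) * w = 0 := by rw [sub_mul, hew, one_mul, sub_self]
  -- Block elimination relative to `e` and `1 - e`: `v₁` and `v₂` are the unipotents clearing the
  -- two off-diagonal blocks, and `v₃` is the pivot.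
  obtain ⟨v₁, h₁⟩ : IsUnit (1 - (1 - e) * y * w) := isUnit_one_sub_of_sq_eq_zero <| by
    calc (1 - e) * y * w * ((1 - e) * y * w) = (1 - e) * y * (w * (1 - e)) * y * w := by
          simp only [mul_assoc]
      _ = 0 := by simp [hwf]
  obtain ⟨v₂, h₂⟩ : IsUnit (1 - w * y * (1 - e)) := isUnit_one_sub_of_sq_eq_zero <| by
    calc w * y * (1 - e) * (w * y * (1 - e)) = w * y * ((1 - e) * w) * y * (1 - e) := by
          simp only [mul_assoc]
      _ = 0 := by simp [hfw]
  obtain ⟨v₃, h₃⟩ : IsUnit (1 - e + e * y * e) := by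
    refine ⟨⟨1 - e + e * y * e, 1 - e + w, ?_, ?_⟩, rfl⟩
    · have h3 : e * y * e * w = e := by rw [mul_assoc (e * y), hew, hr]
      have h4 : e * y * e * e = e * y * e := by rw [mul_assoc (e * y), hee]
      simp only [mul_add, add_mul, mul_sub, sub_mul, mul_one, one_mul, h3, h4, hee, hew]
      abel
    · have h3 : w * (e * y * e) = e := by rw [← hl]; simp only [← mul_assoc, hwe, hl]
      have h4 : e * (e * y * e) = e * y * e := by simp only [← mul_assoc, hee]
      simp only [mul_add, add_mul, mul_sub, sub_mul, mul_one, one_mul, h3, h4, hee, hwe]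
      abel
  have h₄ : (1 - (1 - e) * y * w) * y * (1 - w * y * (1 - e)) = y - y * w * y + e * y * e := by
    have a1 : (1 - (1 - e) * y * w) * y = y - y * w * y + e * y := by
      have : (1 - (1 - e) * y * w) * y = y - y * w * y + e * y * w * y := by noncomm_ring
      rw [this, hr]
    have a2 : (y - y * w * y + e * y) * (w * y * (1 - e))
        = y * w * y - y * (w * y * e) - y * (w * y * w) * y + y * (w * y * w * y * e)
          + e * y * w * y - e * y * w * y * e := by noncomm_ring
    have a3 : w * y * w * y * e = e := by rw [hwyw, hl]
    rw [a1, mul_sub, a2, a3, hl, hwyw, hr]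
    noncomm_ring
  -- The complement `y - y * w * y` is annihilated by `e` on both sides, so the pivot splits off as
  -- a factor.
  have h₅ : y - y * w * y + e * y * e
      = (1 + (y - y * w * y - 1 + e)) * (1 - e + e * y * e) := by
    have h6 : 1 + (y - y * w * y - 1 + e) = y - y * w * y + e := by abel
    have h7 : (y - y * w * y) * e = 0 := by
      rw [sub_mul, mul_assoc y w y, mul_assoc y, hl, sub_self]
    rw [h6, add_mul, mul_add, mul_sub, mul_one, h7, ← mul_assoc, ← mul_assoc, h7, mul_add,
      mul_sub, mul_one, hee, ← mul_assoc, ← mul_assoc, hee]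
    simp
  refine ⟨v₁⁻¹, v₃ * v₂⁻¹, ?_⟩
  rw [← h₁, ← h₂, h₅, ← h₃] at h₄
  rw [Units.val_mul, ← mul_assoc, mul_assoc (↑v₁⁻¹ : R), ← h₄]
  simp [mul_assoc]

/-- If `p` is an idempotent, `x` is a unit and `v` inverts the corner of `x` at `1 - p`,
then the Schur complement of that corner is invertible in the corner ring at `p`. -/
theorem schur_complement_invertible {p v x u : R} (hp : p * p = p) (hpv : p * v = p)
    (hvp : v * p = p) (hv : v * ((1 - p) * x * (1 - p) + p) = 1)
    (hv' : ((1 - p) * x * (1 - p) + p) * v = 1) (hux : u * x = 1) (hxu : x * u = 1) :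
    (p * x * p - p * x * (1 - p) * v * (1 - p) * x * p) * (p * u * p) = p ∧
    (p * u * p) * (p * x * p - p * x * (1 - p) * v * (1 - p) * x * p) = p := by
  have hpx : p * (p * u * p) = p * u * p := by rw [← mul_assoc, ← mul_assoc, hp]
  have hxp : (p * u * p) * p = p * u * p := by rw [mul_assoc, hp]
  have hqq : (1 - p) * (1 - p) = 1 - p := by simp [mul_sub, sub_mul, hp]
  have hpq : p * (1 - p) = 0 := by simp [mul_sub, hp]
  have hqp : (1 - p) * p = 0 := by simp [sub_mul, hp]
  have hvd : v * ((1 - p) * x * (1 - p)) = 1 - p := by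
    rw [mul_add, hvp] at hv
    exact eq_sub_of_add_eq hv
  have hdv : ((1 - p) * x * (1 - p)) * v = 1 - p := by
    rw [add_mul, hpv] at hv'
    exact eq_sub_of_add_eq hv'
  constructor
  -- As in the block inverse formula, the inverse of the Schur complement is the `p`-corner of `u =
  -- x⁻¹`. The identities come from inserting `p + (1 - p)` between `x` and `u`.
  · have e₁ : p * x * p * (p * u * p) = p - p * x * (1 - p) * u * p := by
      rw [mul_assoc _ p, hpx]
      calc p * x * (p * u * p) = p * (x * u) * p - p * x * (1 - p) * u * p := by noncomm_ring
        _ = _ := by rw [hxu, mul_one, hp]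
    have e₂ : (1 - p) * x * p * (p * u * p) = -((1 - p) * x * (1 - p) * (u * p)) := by
      rw [mul_assoc _ p, hpx]
      calc (1 - p) * x * (p * u * p)
          = (1 - p) * (x * u) * p - (1 - p) * x * (1 - p) * (u * p) := by noncomm_ring
        _ = _ := by rw [hxu, mul_one, hqp, zero_sub]
    have e₃ : p * x * (1 - p) * v * (1 - p) * x * p * (p * u * p)
        = -(p * x * (1 - p) * u * p) := by
      calc p * x * (1 - p) * v * (1 - p) * x * p * (p * u * p)
          = p * x * (1 - p) * v * ((1 - p) * x * p * (p * u * p)) := by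
            simp only [mul_assoc]
        _ = -(p * x * (1 - p) * (v * ((1 - p) * x * (1 - p))) * (u * p)) := by
            rw [e₂, mul_neg]; simp only [mul_assoc]
        _ = _ := by rw [hvd, mul_assoc (p * x), hqq]; simp only [mul_assoc]
    rw [sub_mul, e₁, e₃]
    abel
  · have e₁ : p * u * p * (p * x * p) = p - p * u * (1 - p) * x * p := by
      rw [← mul_assoc, ← mul_assoc, hxp]
      calc p * u * p * x * p = p * (u * x) * p - p * u * (1 - p) * x * p := by noncomm_ring
        _ = _ := by rw [hux, mul_one, hp]
    have e₂ : p * u * p * (p * x * (1 - p)) = -(p * u * ((1 - p) * x * (1 - p))) := by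
      rw [← mul_assoc, ← mul_assoc, hxp]
      calc p * u * p * x * (1 - p)
          = p * (u * x) * (1 - p) - p * u * ((1 - p) * x * (1 - p)) := by noncomm_ring
        _ = _ := by rw [hux, mul_one, hpq, zero_sub]
    have e₃ : p * u * p * (p * x * (1 - p) * v * (1 - p) * x * p)
        = -(p * u * (1 - p) * x * p) := by
      calc p * u * p * (p * x * (1 - p) * v * (1 - p) * x * p)
          = p * u * p * (p * x * (1 - p)) * (v * (1 - p) * x * p) := by
            simp only [mul_assoc]
        _ = -(p * u * ((1 - p) * x * (1 - p) * v) * ((1 - p) * (x * p))) := by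
            rw [e₂, neg_mul]; simp only [mul_assoc]
        _ = _ := by rw [hdv, ← mul_assoc, mul_assoc (p * u), hqq]; simp only [mul_assoc]
    rw [mul_sub, e₁, e₃]
    abel

/-- Generation by a pair after a shift: `f` moves the idempotent `p` (which supports `b₂`)
to a place that `b₁` and `b₂` do not meet. -/
theorem pair_left_generating [Algebra ℂ R] {p f g b₁ b₂ : R} {z₁ z₂ ε : ℂ} (hz : z₂ ≠ 0)
    (hε : ε ≠ 0) (hgf : g * f = p) (h₁ : g * b₁ = 0) (h₂ : g * b₂ = 0) (hp : b₂ * p = b₂) :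
    ∃ c₁ c₂ : R, c₁ * (z₁ • 1 + b₁ + ε • f) + c₂ * (z₂ • 1 + b₂) = 1 := by
  -- Multiplying by `b₂ * g` turns the first element into `z₁ • (b₂ * g) + ε • b₂` and the second
  -- into `z₂ • (b₂ * g)`. Hence `b₂` lies in the left ideal, and so does `z₂ • 1`.
  refine ⟨-((z₂⁻¹ * ε⁻¹) • (b₂ * g)), z₂⁻¹ • (1 + (ε⁻¹ * z₁ * z₂⁻¹) • (b₂ * g)), ?_⟩
  have h₁' : b₂ * g * b₁ = 0 := by rw [mul_assoc, h₁, mul_zero]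
  have h₂' : b₂ * g * b₂ = 0 := by rw [mul_assoc, h₂, mul_zero]
  have h₃ : b₂ * g * f = b₂ := by rw [mul_assoc, hgf, hp]
  simp only [mul_add, add_mul, neg_mul, smul_mul_assoc, mul_smul_comm, mul_one, one_mul, h₁',
    h₂', h₃, smul_zero, add_zero, smul_add]
  match_scalars <;> field_simp <;> ring

theorem pair_right_generating [Algebra ℂ R] {p f g b₁ b₂ : R} {z₁ z₂ ε : ℂ} (hz : z₂ ≠ 0)
    (hε : ε ≠ 0) (hfg : f * g = p) (h₁ : b₁ * g = 0) (h₂ : b₂ * g = 0) (hp : p * b₂ = b₂) :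
    ∃ c₁ c₂ : R, (z₁ • 1 + b₁ + ε • f) * c₁ + (z₂ • 1 + b₂) * c₂ = 1 := by
  refine ⟨-((z₂⁻¹ * ε⁻¹) • (g * b₂)), z₂⁻¹ • (1 + (ε⁻¹ * z₁ * z₂⁻¹) • (g * b₂)), ?_⟩
  have h₁' : b₁ * (g * b₂) = 0 := by rw [← mul_assoc, h₁, zero_mul]
  have h₂' : b₂ * (g * b₂) = 0 := by rw [← mul_assoc, h₂, zero_mul]
  have h₃ : f * (g * b₂) = b₂ := by rw [← mul_assoc, hfg, hp]
  simp only [mul_add, add_mul, mul_neg, smul_mul_assoc, mul_smul_comm, mul_one, one_mul, h₁',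
    h₂', h₃, add_zero, smul_add]
  match_scalars <;> field_simp <;> ring

end Algebra

section ClosureOfUnits

variable {R : Type*} [NormedRing R]

theorem unit_mul_mem_closure (u : Rˣ) {x : R} (hx : x ∈ closure {a : R | IsUnit a}) :
    ↑u * x ∈ closure {a : R | IsUnit a} :=
  map_mem_closure (continuous_const_mul (u : R)) hx fun _ ha => u.isUnit.mul ha

theorem mul_unit_mem_closure (u : Rˣ) {x : R} (hx : x ∈ closure {a : R | IsUnit a}) :
    x * ↑u ∈ closure {a : R | IsUnit a} :=
  map_mem_closure (f := fun y : R => y * u) (continuous_mul_const (u : R)) hx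
    fun _ ha => IsUnit.mul ha u.isUnit

end ClosureOfUnits

/-! ### Matrix units in a unital normed algebra. -/

section MatrixSystem

variable {A : Type*} [NormedRing A] [NormedAlgebra ℂ A]
  {R : Type*} [NormedRing R] [NormedAlgebra ℂ R]

/-- The span of the `μ i j a` with `i, j < n`. -/
noncomputable def block (μ : ℕ → ℕ → A →ₗ[ℂ] R) (n : ℕ) : Submodule ℂ R :=
  Submodule.span ℂ {x | ∃ (a : A) (i j : ℕ), i < n ∧ j < n ∧ x = μ i j a}

/-- `μ i j a` behaves like the matrix `a ⊗ E i j` in the unital algebra `R`, which is the closed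
span of these matrices and the identity. -/
structure IsMatrixSystem (μ : ℕ → ℕ → A →ₗ[ℂ] R) : Prop where
  mul_same : ∀ i j k a b, μ i j a * μ j k b = μ i k (a * b)
  mul_of_ne : ∀ i j k l a b, j ≠ k → μ i j a * μ k l b = 0
  norm_map : ∀ i j a, ‖μ i j a‖ = ‖a‖
  dense_block : Dense {x : R | ∃ (z : ℂ) (n : ℕ), ∃ s ∈ block μ n, x = z • 1 + s}
  -- This is required for every `x : R`, not only for finite matrices, since inverses of units need
  -- not be finite.
  corner : ∀ x : R, ∃ a, μ 0 0 1 * x * μ 0 0 1 = μ 0 0 a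

variable {μ : ℕ → ℕ → A →ₗ[ℂ] R}

theorem mem_block {n i j : ℕ} (hi : i < n) (hj : j < n) (a : A) : μ i j a ∈ block μ n :=
  Submodule.subset_span ⟨a, i, j, hi, hj, rfl⟩

theorem block_mono {m n : ℕ} (h : m ≤ n) : block μ m ≤ block μ n :=
  Submodule.span_mono fun _ ⟨a, i, j, hi, hj, hx⟩ => ⟨a, i, j, hi.trans_le h, hj.trans_le h, hx⟩

namespace IsMatrixSystem

variable (hμ : IsMatrixSystem μ)
include hμ

theorem isometry (i j : ℕ) : Isometry (μ i j) :=
  AddMonoidHomClass.isometry_of_norm (μ i j) (hμ.norm_map i j)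

theorem mul_mem_block {n : ℕ} {x y : R} (hx : x ∈ block μ n) (hy : y ∈ block μ n) :
    x * y ∈ block μ n := by
  refine Submodule.span_induction (p := fun x _ => x * y ∈ block μ n) ?_ (by simp)
    (fun a b _ _ ha hb => by rw [add_mul]; exact add_mem ha hb)
    (fun c a _ ha => by rw [smul_mul_assoc]; exact Submodule.smul_mem _ c ha) hx
  rintro _ ⟨a, i, j, hi, hj, rfl⟩
  refine Submodule.span_induction (p := fun y _ => μ i j a * y ∈ block μ n) ?_ (by simp)
    (fun a b _ _ ha hb => by rw [mul_add]; exact add_mem ha hb)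
    (fun c a _ ha => by rw [mul_smul_comm]; exact Submodule.smul_mem _ c ha) hy
  rintro _ ⟨b, k, l, hk, hl, rfl⟩
  by_cases h : j = k
  · subst h
    rw [hμ.mul_same]
    exact mem_block hi hl _
  · rw [hμ.mul_of_ne _ _ _ _ _ _ h]
    exact zero_mem _

/-- Left multiplication by `μ i j 1` kills the blocks that stop before row `j`. -/
theorem mul_block_eq_zero {n i j : ℕ} (h : n ≤ j) (a : A) {x : R} (hx : x ∈ block μ n) :
    μ i j a * x = 0 := by
  refine Submodule.span_induction (p := fun x _ => μ i j a * x = 0) ?_ (by simp)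
    (fun a b _ _ ha hb => by rw [mul_add, ha, hb, add_zero])
    (fun c a _ ha => by rw [mul_smul_comm, ha, smul_zero]) hx
  rintro _ ⟨b, k, l, hk, hl, rfl⟩
  exact hμ.mul_of_ne _ _ _ _ _ _ (by omega)

theorem block_mul_eq_zero {n i j : ℕ} (h : n ≤ i) (a : A) {x : R} (hx : x ∈ block μ n) :
    x * μ i j a = 0 := by
  refine Submodule.span_induction (p := fun x _ => x * μ i j a = 0) ?_ (by simp)
    (fun a b _ _ ha hb => by rw [add_mul, ha, hb, add_zero])
    (fun c a _ ha => by rw [smul_mul_assoc, ha, smul_zero]) hx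
  rintro _ ⟨b, k, l, hk, hl, rfl⟩
  exact hμ.mul_of_ne _ _ _ _ _ _ (by omega)

theorem diag_mul {n : ℕ} {x : R} (hx : x ∈ block μ n) :
    (∑ i ∈ Finset.range n, μ i i 1) * x = x := by
  refine Submodule.span_induction (p := fun x _ => (∑ i ∈ Finset.range n, μ i i 1) * x = x)
    ?_ (by simp) (fun a b _ _ ha hb => by rw [mul_add, ha, hb])
    (fun c a _ ha => by rw [mul_smul_comm, ha]) hx
  rintro _ ⟨b, k, l, hk, hl, rfl⟩
  rw [Finset.sum_mul, Finset.sum_eq_single k, hμ.mul_same, one_mul]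
  · exact fun i _ hik => hμ.mul_of_ne _ _ _ _ _ _ hik
  · exact fun h => absurd (Finset.mem_range.2 hk) h

theorem mul_diag {n : ℕ} {x : R} (hx : x ∈ block μ n) :
    x * (∑ i ∈ Finset.range n, μ i i 1) = x := by
  refine Submodule.span_induction (p := fun x _ => x * (∑ i ∈ Finset.range n, μ i i 1) = x)
    ?_ (by simp) (fun a b _ _ ha hb => by rw [add_mul, ha, hb])
    (fun c a _ ha => by rw [smul_mul_assoc, ha]) hx
  rintro _ ⟨b, k, l, hk, hl, rfl⟩
  rw [Finset.mul_sum, Finset.sum_eq_single l, hμ.mul_same, mul_one]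
  · exact fun i _ hil => hμ.mul_of_ne _ _ _ _ _ _ (Ne.symm hil)
  · exact fun h => absurd (Finset.mem_range.2 hl) h

theorem shift_mul_shift (n : ℕ) :
    (∑ i ∈ Finset.range n, μ i (n + i) 1) * (∑ i ∈ Finset.range n, μ (n + i) i 1)
      = ∑ i ∈ Finset.range n, μ i i 1 := by
  rw [Finset.sum_mul_sum]
  refine Finset.sum_congr rfl fun i hi => ?_
  rw [Finset.sum_eq_single i, hμ.mul_same, one_mul]
  · exact fun j _ hji => hμ.mul_of_ne _ _ _ _ _ _ (by omega)
  · exact fun h => absurd hi h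

/-- A nonzero scalar part can be divided out, which both the generating pairs and the reduction to
`1 + s` need. -/
theorem dense_ne_zero :
    Dense {x : R | ∃ (z : ℂ) (n : ℕ), z ≠ 0 ∧ ∃ s ∈ block μ n, x = z • 1 + s} := by
  refine dense_closure.1 (hμ.dense_block.mono ?_)
  rintro _ ⟨z, n, s, hs, rfl⟩
  refine map_mem_closure (f := fun z : ℂ => z • (1 : R) + s) (s := {0}ᶜ) (by fun_prop)
    (dense_compl_singleton (0 : ℂ) z) ?_
  exact fun w hw => ⟨w, n, hw, s, hs, rfl⟩

/-- The shift sends indices below `n` to rows `n, ..., 2n - 1`, where `s₁` and `s₂` vanish. The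
perturbed pair generates for each `ε ≠ 0`, and `ε` tends to 0. -/
theorem dense_Lg_two : Dense (Lg R 2) := by
  refine dense_closure.1 ((dense_pi Set.univ fun (_ : Fin 2) _ => hμ.dense_ne_zero).mono ?_)
  intro x hx
  obtain ⟨z₁, n₁, -, s₁, hs₁, h₁⟩ := hx 0 trivial
  obtain ⟨z₂, n₂, hz₂, s₂, hs₂, h₂⟩ := hx 1 trivial
  set n := max n₁ n₂
  replace hs₁ := block_mono (le_max_left n₁ n₂) hs₁
  replace hs₂ := block_mono (le_max_right n₁ n₂) hs₂
  have hc := map_mem_closure (t := Lg R 2)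
    (f := fun ε : ℂ => ![z₁ • (1 : R) + s₁ + ε • ∑ i ∈ Finset.range n, μ (n + i) i 1,
      z₂ • (1 : R) + s₂]) (s := {0}ᶜ) (by fun_prop) (dense_compl_singleton (0 : ℂ) 0) ?_
  · convert hc using 1
    ext i
    fin_cases i <;> simp [h₁, h₂]
  · intro ε hε
    obtain ⟨c₁, c₂, hc⟩ := pair_left_generating (z₁ := z₁) hz₂ hε (hμ.shift_mul_shift n)
      (by rw [Finset.sum_mul]
          exact Finset.sum_eq_zero fun i _ => hμ.mul_block_eq_zero (by omega) _ hs₁)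
      (by rw [Finset.sum_mul]
          exact Finset.sum_eq_zero fun i _ => hμ.mul_block_eq_zero (by omega) _ hs₂)
      (hμ.mul_diag hs₂)
    exact ⟨![c₁, c₂], by simpa using hc⟩

theorem dense_Rg_two : Dense (Rg R 2) := by
  refine dense_closure.1 ((dense_pi Set.univ fun (_ : Fin 2) _ => hμ.dense_ne_zero).mono ?_)
  intro x hx
  obtain ⟨z₁, n₁, -, s₁, hs₁, h₁⟩ := hx 0 trivial
  obtain ⟨z₂, n₂, hz₂, s₂, hs₂, h₂⟩ := hx 1 trivial
  set n := max n₁ n₂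
  replace hs₁ := block_mono (le_max_left n₁ n₂) hs₁
  replace hs₂ := block_mono (le_max_right n₁ n₂) hs₂
  have hc := map_mem_closure (t := Rg R 2)
    (f := fun ε : ℂ => ![z₁ • (1 : R) + s₁ + ε • ∑ i ∈ Finset.range n, μ i (n + i) 1,
      z₂ • (1 : R) + s₂]) (s := {0}ᶜ) (by fun_prop) (dense_compl_singleton (0 : ℂ) 0) ?_
  · convert hc using 1
    ext i
    fin_cases i <;> simp [h₁, h₂]
  · intro ε hε
    obtain ⟨c₁, c₂, hc⟩ := pair_right_generating (z₁ := z₁) hz₂ hε (hμ.shift_mul_shift n)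
      (by rw [Finset.mul_sum]
          exact Finset.sum_eq_zero fun i _ => hμ.block_mul_eq_zero (by omega) _ hs₁)
      (by rw [Finset.mul_sum]
          exact Finset.sum_eq_zero fun i _ => hμ.block_mul_eq_zero (by omega) _ hs₂)
      (hμ.diag_mul hs₂)
    exact ⟨![c₁, c₂], by simpa using hc⟩

/-! ### Transfer of density of units between `A` and `R`. -/

theorem exists_diag_entry {n : ℕ} {x : R} (k : ℕ) (hx : x ∈ block μ n) :
    ∃ a, μ k k 1 * x * μ k k 1 = μ k k a := by
  refine Submodule.span_induction (p := fun x _ => ∃ a, μ k k 1 * x * μ k k 1 = μ k k a)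
    ?_ ⟨0, by simp⟩ ?_ ?_ hx
  · rintro _ ⟨b, i, j, hi, hj, rfl⟩
    by_cases h : k = i
    · subst h
      by_cases h' : j = k
      · subst h'
        exact ⟨1 * b * 1, by rw [hμ.mul_same, hμ.mul_same]⟩
      · exact ⟨0, by rw [hμ.mul_same, hμ.mul_of_ne _ _ _ _ _ _ h', map_zero]⟩
    · exact ⟨0, by rw [hμ.mul_of_ne _ _ _ _ _ _ h, zero_mul, map_zero]⟩
  · rintro x y _ _ ⟨a, ha⟩ ⟨b, hb⟩
    exact ⟨a + b, by rw [mul_add, add_mul, ha, hb, map_add]⟩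
  · rintro c x _ ⟨a, ha⟩
    exact ⟨c • a, by rw [mul_smul_comm, smul_mul_assoc, ha, map_smul]⟩

/-- Compression by the first `n` diagonal units lands in the smaller block and fixes such an `x`.
This is how a Schur complement is seen to lose one dimension. -/
theorem mem_block_of_succ {n : ℕ} {x : R} (hx : x ∈ block μ (n + 1)) (hl : μ n n 1 * x = 0)
    (hr : x * μ n n 1 = 0) : x ∈ block μ n := by
  have key : ∀ y ∈ block μ (n + 1),
      (∑ i ∈ Finset.range n, μ i i 1) * y * (∑ i ∈ Finset.range n, μ i i 1) ∈ block μ n := by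
    intro y hy
    refine Submodule.span_induction (p := fun y _ =>
      (∑ i ∈ Finset.range n, μ i i 1) * y * (∑ i ∈ Finset.range n, μ i i 1) ∈ block μ n)
      ?_ (by simp) (fun a b _ _ ha hb => by rw [mul_add, add_mul]; exact add_mem ha hb)
      (fun c a _ ha => by
        rw [mul_smul_comm, smul_mul_assoc]; exact Submodule.smul_mem _ c ha) hy
    rintro _ ⟨b, k, l, hk, hl, rfl⟩
    rw [Finset.sum_mul, Finset.sum_mul]
    refine sum_mem fun i hi => ?_
    rw [Finset.mul_sum]
    refine sum_mem fun j hj => ?_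
    by_cases h : i = k
    · subst h
      by_cases h' : l = j
      · subst h'
        rw [hμ.mul_same, hμ.mul_same]
        exact mem_block (Finset.mem_range.1 hi) (Finset.mem_range.1 hj) _
      · rw [hμ.mul_same, hμ.mul_of_ne _ _ _ _ _ _ h']
        exact zero_mem _
    · rw [hμ.mul_of_ne _ _ _ _ _ _ h, zero_mul]
      exact zero_mem _
  have h₁ := hμ.diag_mul hx
  have h₂ := hμ.mul_diag hx
  rw [Finset.sum_range_succ, add_mul, hl, add_zero] at h₁
  rw [Finset.sum_range_succ, mul_add, hr, add_zero] at h₂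
  have := key x hx
  rwa [h₁, h₂] at this

/-- If the units of `A` are dense, then every `1 + s` with `s` a finite matrix is a limit of
units. -/
theorem one_add_mem_closure (hA : Dense {a : A | IsUnit a}) (n : ℕ) :
    ∀ s ∈ block μ n, 1 + s ∈ closure {x : R | IsUnit x} := by
  induction n with
  | zero =>
    intro s hs
    have : s = 0 := by simpa [block] using hs
    subst this
    exact subset_closure (by simp)
  | succ n ih =>
    intro s hs
    obtain ⟨a, ha⟩ := hμ.exists_diag_entry n hs
    have hee : μ n n 1 * μ n n 1 = μ n n 1 := by rw [hμ.mul_same, one_mul]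
    -- The last diagonal entry of `1 + s` is `1 + a`; this map replaces it by `b`, so units `b` near
    -- `1 + a` suffice.
    have hc := map_mem_closure (f := fun b : A => 1 + (s + μ n n (b - (1 + a))))
      (t := closure {x : R | IsUnit x})
      (continuous_const.add (continuous_const.add
        ((hμ.isometry n n).continuous.comp (continuous_id.sub continuous_const))))
      (hA (1 + a)) ?_
    · simpa using hc
    rintro _ ⟨u, rfl⟩
    set t := s + μ n n (↑u - (1 + a)) with ht
    have htm : t ∈ block μ (n + 1) := add_mem hs (mem_block (by omega) (by omega) _)
    have hen : ∀ b, μ n n 1 * μ n n b = μ n n b := fun b => by rw [hμ.mul_same, one_mul]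
    have hne : ∀ b, μ n n b * μ n n 1 = μ n n b := fun b => by rw [hμ.mul_same, mul_one]
    have hdiag : μ n n 1 * (1 + t) * μ n n 1 = μ n n u := by
      have : μ n n 1 * (1 + t) * μ n n 1
          = μ n n 1 * μ n n 1 + μ n n 1 * s * μ n n 1
            + μ n n 1 * μ n n (↑u - (1 + a)) * μ n n 1 := by
        rw [ht]; noncomm_ring
      rw [this, ha, hee, hen, hne, ← map_add, ← map_add]
      congr 1
      abel
    have hl : μ n n ↑u⁻¹ * (1 + t) * μ n n 1 = μ n n 1 := by
      calc μ n n ↑u⁻¹ * (1 + t) * μ n n 1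
          = μ n n ↑u⁻¹ * (μ n n 1 * (1 + t) * μ n n 1) := by
            rw [← hne (↑u⁻¹ : A)]; simp only [mul_assoc]
            rw [← mul_assoc (μ n n 1) (μ n n 1), hee]
        _ = _ := by rw [hdiag, hμ.mul_same, Units.inv_mul]
    have hr : μ n n 1 * (1 + t) * μ n n ↑u⁻¹ = μ n n 1 := by
      calc μ n n 1 * (1 + t) * μ n n ↑u⁻¹
          = (μ n n 1 * (1 + t) * μ n n 1) * μ n n ↑u⁻¹ := by
            rw [mul_assoc _ (μ n n 1) (μ n n _), hen]
        _ = _ := by rw [hdiag, hμ.mul_same, Units.mul_inv]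
    obtain ⟨u₁, u₂, hu⟩ := schur_factorization (hen _) (hne _) hl hr
    show 1 + t ∈ _
    rw [hu]
    refine mul_unit_mem_closure _ (unit_mul_mem_closure _ (ih _ ?_))
    have hw : μ n n ↑u⁻¹ ∈ block μ (n + 1) := mem_block (by omega) (by omega) _
    refine hμ.mem_block_of_succ ?_ ?_ ?_
    -- The two identities cancel, leaving only finite matrices.
    · have : (1 + t) - (1 + t) * μ n n ↑u⁻¹ * (1 + t) - 1 + μ n n 1
          = t - (μ n n ↑u⁻¹ + t * μ n n ↑u⁻¹ + μ n n ↑u⁻¹ * t + t * μ n n ↑u⁻¹ * t)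
            + μ n n 1 := by
        noncomm_ring
      rw [this]
      refine add_mem (sub_mem htm (add_mem (add_mem (add_mem hw ?_) ?_) ?_))
        (mem_block (by omega) (by omega) _)
      · exact hμ.mul_mem_block htm hw
      · exact hμ.mul_mem_block hw htm
      · exact hμ.mul_mem_block (hμ.mul_mem_block htm hw) htm
    · rw [mul_add, mul_sub, mul_sub, ← mul_assoc, ← mul_assoc, hr, hee, mul_one]
      abel
    · rw [add_mul, sub_mul, sub_mul, mul_assoc, mul_assoc, ← mul_assoc (μ n n ↑u⁻¹), hl, hee,
        one_mul]
      abel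

theorem dense_isUnit_of_dense (hA : Dense {a : A | IsUnit a}) : Dense {x : R | IsUnit x} := by
  refine dense_closure.1 (hμ.dense_ne_zero.mono ?_)
  rintro _ ⟨z, n, hz, s, hs, rfl⟩
  have := unit_mul_mem_closure (Units.map (algebraMap ℂ R).toMonoidHom (Units.mk0 z hz))
    (hμ.one_add_mem_closure hA n _ (Submodule.smul_mem _ z⁻¹ hs))
  simpa [mul_add, ← Algebra.smul_def, smul_smul, hz, Algebra.algebraMap_eq_smul_one] using this

/-- Near `x₀ = a ⊕ 1` the `1 - p` corner is invertible, so the Schur complement `f` is continuous at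
`x₀`, with value `a` there. At units of `R` near `x₀` it is invertible in the corner at `p`, a copy
of `A`. -/
theorem dense_isUnit_of_dense_isUnit [CompleteSpace R] (hR : Dense {x : R | IsUnit x}) :
    Dense {a : A | IsUnit a} := by
  intro a
  rw [(hμ.isometry 0 0).isUniformInducing.isInducing.closure_eq_preimage_closure_image]
  set p := μ 0 0 1 with hpdef
  have hp : p * p = p := by rw [hpdef, hμ.mul_same, one_mul]
  have hpa : p * μ 0 0 a = μ 0 0 a := by rw [hpdef, hμ.mul_same, one_mul]
  have hap : μ 0 0 a * p = μ 0 0 a := by rw [hpdef, hμ.mul_same, mul_one]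
  have hqp : (1 - p) * p = 0 := by rw [sub_mul, one_mul, hp, sub_self]
  have hpq : p * (1 - p) = 0 := by rw [mul_sub, mul_one, hp, sub_self]
  have hqq : (1 - p) * (1 - p) = 1 - p := by rw [mul_sub, mul_one, hqp, sub_zero]
  have haq : μ 0 0 a * (1 - p) = 0 := by rw [mul_sub, mul_one, hap, sub_self]
  -- Adding `p` lets the corner at `1 - p` be inverted in `R` itself. `Ring.inverse` is 0 at
  -- non-units, but only `x` near `x₀`, where `d x` is a unit, matter.
  let d : R → R := fun x => (1 - p) * x * (1 - p) + p
  let f : R → R := fun x =>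
    p * x * p - p * x * (1 - p) * Ring.inverse (d x) * (1 - p) * x * p
  let x₀ : R := μ 0 0 a + (1 - p)
  have hd₀ : d x₀ = 1 := by
    simp only [d, x₀]
    rw [mul_assoc, add_mul, haq, zero_add, hqq, hqq, sub_add_cancel]
  have hf₀ : f x₀ = μ 0 0 a := by
    simp only [f, x₀]
    have h₁ : p * (μ 0 0 a + (1 - p)) = μ 0 0 a := by rw [mul_add, hpa, hpq, add_zero]
    rw [h₁, haq, hap]
    simp
  have hdc : Continuous d := by fun_prop
  have hinv : ContinuousAt (fun x => Ring.inverse (d x)) x₀ := by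
    refine ContinuousAt.comp (g := Ring.inverse) ?_ hdc.continuousAt
    rw [hd₀]
    exact NormedRing.inverse_continuousAt (1 : Rˣ)
  have hfc : Tendsto f (𝓝 x₀) (𝓝 (μ 0 0 a)) := by
    have : ContinuousAt f x₀ := by fun_prop
    rw [← hf₀]
    exact this
  have hdu : ∀ᶠ x in 𝓝 x₀, IsUnit (d x) := by
    refine hdc.continuousAt.eventually ?_
    rw [hd₀]
    exact Units.nhds (1 : Rˣ)
  refine mem_closure_of_frequently_of_tendsto
    (((mem_closure_iff_frequently.1 (hR x₀)).and_eventually hdu).mono ?_) hfc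
  rintro _ ⟨⟨w, rfl⟩, hw⟩
  have hv := Ring.inverse_mul_cancel _ hw
  have hv' := Ring.mul_inverse_cancel _ hw
  simp only [f]
  set v := Ring.inverse (d w)
  have hdp : d w * p = p := by
    simp only [d]
    rw [add_mul, mul_assoc, hqp, mul_zero, zero_add, hp]
  have hpd : p * d w = p := by
    simp only [d]
    rw [mul_add, mul_assoc (1 - p), ← mul_assoc p, hpq, zero_mul, zero_add, hp]
  have hvp : v * p = p := by
    calc v * p = v * (d w * p) := by rw [hdp]
      _ = p := by rw [← mul_assoc, hv, one_mul]
  have hpv : p * v = p := by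
    calc p * v = p * d w * v := by rw [hpd]
      _ = p := by rw [mul_assoc, hv', mul_one]
  obtain ⟨h₁, h₂⟩ := schur_complement_invertible hp hpv hvp hv hv' w.inv_mul w.mul_inv
  -- Both the Schur complement and its inverse `p * w⁻¹ * p` come from elements of `A`; injectivity
  -- of `μ 0 0` makes these mutually inverse.
  obtain ⟨b, hb⟩ := hμ.corner (↑w - ↑w * (1 - p) * v * (1 - p) * ↑w)
  obtain ⟨c, hc⟩ := hμ.corner ↑w⁻¹
  have hb' : p * ↑w * p - p * ↑w * (1 - p) * v * (1 - p) * ↑w * p = μ 0 0 b := by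
    rw [← hb, ← hpdef, mul_sub p, sub_mul _ _ p]
    simp only [mul_assoc]
  rw [hb', hc, hμ.mul_same] at h₁ h₂
  have hinj := (hμ.isometry 0 0).injective
  rw [hb']
  exact ⟨b, ⟨⟨b, c, hinj h₁, hinj h₂⟩, rfl⟩, rfl⟩

end IsMatrixSystem

end MatrixSystem

/-! ### The matrix units of `B` inside its unitization. -/

section Completion

variable {A : Type*} [NormedRing A] [NormedAlgebra ℂ A]
  {H : Type*} [NormedAddCommGroup H] [InnerProductSpace ℂ H]

theorem matrixUnit_mul_same (e : HilbertBasis ℕ ℂ H) (i j k : ℕ) :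
    matrixUnit e i j * matrixUnit e j k = matrixUnit e i k := by
  ext v
  simp [matrixUnit, InnerProductSpace.rankOne_apply, e.orthonormal.1 j]

theorem matrixUnit_mul_of_ne (e : HilbertBasis ℕ ℂ H) (i l : ℕ) {j k : ℕ} (h : j ≠ k) :
    matrixUnit e i j * matrixUnit e k l = 0 := by
  ext v
  simp [matrixUnit, InnerProductSpace.rankOne_apply,
    e.orthonormal.inner_eq_zero h]

theorem norm_matrixUnit (e : HilbertBasis ℕ ℂ H) (i j : ℕ) : ‖matrixUnit e i j‖ = 1 := by
  change ‖(InnerProductSpace.rankOne ℂ (e i) (e j) : H →L[ℂ] H)‖ = 1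
  rw [InnerProductSpace.norm_rankOne, e.orthonormal.1, e.orthonormal.1, one_mul]

variable {B : Type*} [NonUnitalNormedRing B] [NormedSpace ℂ B] [IsScalarTower ℂ B B]
    [SMulCommClass ℂ B B]

/-- The inclusion of `B` in its unitization. -/
noncomputable def unitizationInr (B : Type*) [NonUnitalNormedRing B] [NormedSpace ℂ B]
    [IsScalarTower ℂ B B] [SMulCommClass ℂ B B] : B →ₗ[ℂ] WithLp 1 (Unitization ℂ B) where
  toFun b := WithLp.toLp 1 (b : Unitization ℂ B)
  map_add' x y := by rw [Unitization.inr_add]; rfl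
  map_smul' c x := by rw [Unitization.inr_smul]; rfl

theorem unitizationInr_mul (x y : B) :
    unitizationInr B (x * y) = unitizationInr B x * unitizationInr B y :=
  congrArg (WithLp.toLp 1) (Unitization.inr_mul ℂ x y)

theorem norm_unitizationInr (x : B) : ‖unitizationInr B x‖ = ‖x‖ :=
  WithLp.unitization_norm_inr x

theorem exists_eq_smul_one_add (x : WithLp 1 (Unitization ℂ B)) :
    ∃ (z : ℂ) (b : B), x = z • 1 + unitizationInr B b := by
  refine ⟨(WithLp.ofLp x).fst, (WithLp.ofLp x).snd, ?_⟩
  apply WithLp.ofLp_injective 1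
  change WithLp.ofLp x = (WithLp.ofLp x).fst • (1 : Unitization ℂ B) +
    ((WithLp.ofLp x).snd : Unitization ℂ B)
  ext <;> simp

/-- The matrices `a ⊗ E i j` in the unitization of `B`. -/
noncomputable def matrixEntry (e : HilbertBasis ℕ ℂ H) (ι : (A ⊗[ℂ] Compacts H) →ₙₐ[ℂ] B)
    (i j : ℕ) : A →ₗ[ℂ] WithLp 1 (Unitization ℂ B) :=
  unitizationInr B ∘ₗ (⟨⟨ι, map_add ι⟩, map_smul ι⟩ : (A ⊗[ℂ] Compacts H) →ₗ[ℂ] B) ∘ₗ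
    (TensorProduct.mk ℂ A (Compacts H)).flip (matrixUnit e i j)

theorem matrixEntry_apply (e : HilbertBasis ℕ ℂ H) (ι : (A ⊗[ℂ] Compacts H) →ₙₐ[ℂ] B)
    (i j : ℕ) (a : A) :
    matrixEntry e ι i j a = unitizationInr B (ι (a ⊗ₜ matrixUnit e i j)) := rfl

theorem unitizationInr_mem_block (e : HilbertBasis ℕ ℂ H) (ι : (A ⊗[ℂ] Compacts H) →ₙₐ[ℂ] B)
    {n : ℕ} {x : A ⊗[ℂ] Compacts H} (hx : x ∈ matrixPart A e n) :
    unitizationInr B (ι x) ∈ block (matrixEntry e ι) n := by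
  refine Submodule.span_induction
    (p := fun x _ => unitizationInr B (ι x) ∈ block (matrixEntry e ι) n) ?_ (by simp)
    (fun x y _ _ hx hy => by rw [map_add, map_add]; exact add_mem hx hy)
    (fun c x _ hx => by rw [map_smul, map_smul]; exact Submodule.smul_mem _ c hx) hx
  rintro _ ⟨a, i, j, hi, hj, rfl⟩
  exact mem_block (μ := matrixEntry e ι) hi hj a

theorem block_one_le_range {R : Type*} [NormedRing R] [NormedAlgebra ℂ R]
    (μ : ℕ → ℕ → A →ₗ[ℂ] R) : block μ 1 ≤ LinearMap.range (μ 0 0) := by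
  refine Submodule.span_le.2 ?_
  rintro _ ⟨a, i, j, hi, hj, rfl⟩
  obtain rfl : i = 0 := by omega
  obtain rfl : j = 0 := by omega
  exact ⟨a, rfl⟩

theorem IsCrossNormCompletion.isMatrixSystem {e : HilbertBasis ℕ ℂ H}
    {ι : (A ⊗[ℂ] Compacts H) →ₙₐ[ℂ] B} (hι : IsCrossNormCompletion e ι) :
    IsMatrixSystem (matrixEntry e ι) where
  mul_same i j k a b := by
    simp only [matrixEntry_apply]
    rw [← unitizationInr_mul, ← map_mul, Algebra.TensorProduct.tmul_mul_tmul,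
      matrixUnit_mul_same]
  mul_of_ne i j k l a b h := by
    simp only [matrixEntry_apply]
    rw [← unitizationInr_mul, ← map_mul, Algebra.TensorProduct.tmul_mul_tmul,
      matrixUnit_mul_of_ne e i l h, TensorProduct.tmul_zero, map_zero, map_zero]
  norm_map i j a := by
    rw [matrixEntry_apply, norm_unitizationInr, hι.norm_tmul, norm_matrixUnit, mul_one]
  dense_block := by
    intro x
    obtain ⟨z, b, rfl⟩ := exists_eq_smul_one_add x
    have hc : Continuous (unitizationInr B) :=
      (AddMonoidHomClass.isometry_of_norm _ norm_unitizationInr).continuous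
    refine map_mem_closure (f := fun b : B => z • 1 + unitizationInr B b)
      (continuous_const.add hc) (hι.dense_matrixPart b) ?_
    intro y hy
    obtain ⟨n, y, hyn, rfl⟩ := Set.mem_iUnion.1 hy
    exact ⟨z, n, _, unitizationInr_mem_block e ι hyn, rfl⟩
  corner x := by
    obtain ⟨z, b, rfl⟩ := exists_eq_smul_one_add x
    have hu : matrixEntry e ι 0 0 1 = unitizationInr B (ι (cornerUnit A e 1)) := by
      simp [matrixEntry_apply, cornerUnit]
    have h₁ : matrixEntry e ι 0 0 1 * unitizationInr B b * matrixEntry e ι 0 0 1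
        ∈ LinearMap.range (matrixEntry e ι 0 0) := by
      -- For `n = 1` the corner of `B` is exactly `A ⊗ E 0 0`; the scalar part of `x` only adds `z •
      -- 1` to the entry.
      obtain ⟨y, hy, hyb⟩ := (hι.corner_eq 1).subset ⟨b, rfl⟩
      dsimp only at hyb
      rw [hu, ← unitizationInr_mul, ← unitizationInr_mul, ← hyb]
      exact block_one_le_range _ (unitizationInr_mem_block e ι hy)
    obtain ⟨a, ha⟩ := h₁
    refine ⟨z • 1 + a, ?_⟩
    rw [map_add, ha, map_smul, mul_add, add_mul, mul_smul_comm, mul_one, smul_mul_assoc]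
    congr 2
    simp only [matrixEntry_apply]
    rw [← unitizationInr_mul, ← map_mul, Algebra.TensorProduct.tmul_mul_tmul,
      matrixUnit_mul_same, one_mul]

end Completion

end StableRank

theorem proposition2p12
    {A : Type*} [NormedRing A] [NormedAlgebra ℂ A] [CompleteSpace A]
    {H : Type*} [NormedAddCommGroup H] [InnerProductSpace ℂ H] [CompleteSpace H]
    (e : HilbertBasis ℕ ℂ H)
    {B : Type*} [NonUnitalNormedRing B] [NormedSpace ℂ B] [IsScalarTower ℂ B B]
    [SMulCommClass ℂ B B] [CompleteSpace B]
    (ι : (A ⊗[ℂ] StableRank.Compacts H) →ₙₐ[ℂ] B)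
    (hι : StableRank.IsCrossNormCompletion e ι) :
    StableRank.ltsrNonUnital B = StableRank.rtsrNonUnital B ∧
    (StableRank.ltsrNonUnital B = 1 ∨ StableRank.ltsrNonUnital B = 2) ∧
    (StableRank.ltsrNonUnital B = 1 ↔ StableRank.ltsr A = 1 ∧ StableRank.rtsr A = 1) ∧
    ((StableRank.ltsr A = 1 ∧ StableRank.rtsr A = 1) ↔ Dense {a : A | IsUnit a}) := by
  have hμ := hι.isMatrixSystem
  have hAB : Dense {x : WithLp 1 (Unitization ℂ B) | IsUnit x} ↔ Dense {a : A | IsUnit a} :=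
    ⟨hμ.dense_isUnit_of_dense_isUnit, hμ.dense_isUnit_of_dense⟩
  have hl : StableRank.ltsrNonUnital B = 1 ↔ Dense {a : A | IsUnit a} :=
    StableRank.ltsr_eq_one_iff.trans hAB
  have hr : StableRank.rtsrNonUnital B = 1 ↔ Dense {a : A | IsUnit a} :=
    StableRank.rtsr_eq_one_iff.trans hAB
  have hl₂ : StableRank.ltsrNonUnital B = 1 ∨ StableRank.ltsrNonUnital B = 2 :=
    StableRank.sInf_natCast_eq_one_or_two hμ.dense_Lg_two
  have hr₂ : StableRank.rtsrNonUnital B = 1 ∨ StableRank.rtsrNonUnital B = 2 :=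
    StableRank.sInf_natCast_eq_one_or_two hμ.dense_Rg_two
  have hA : (StableRank.ltsr A = 1 ∧ StableRank.rtsr A = 1) ↔ Dense {a : A | IsUnit a} := by
    rw [StableRank.ltsr_eq_one_iff, StableRank.rtsr_eq_one_iff, and_self_iff]
  refine ⟨?_, hl₂, hl.trans hA.symm, hA⟩
  -- Each rank is 1 or 2, and each is 1 under the same condition, so they agree.
  by_cases h : Dense {a : A | IsUnit a}
  · rw [hl.2 h, hr.2 h]
  · rw [hl₂.resolve_left (mt hl.1 h), hr₂.resolve_left (mt hr.1 h)]
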